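/- Let $1\le d<D$ be integers, let $\mathcal X\subseteq\mathbb R^D$, and let $f:\mathcal X\to\mathbb R$ be Lipschitz continuous with constant $L$, i.e. $|f(x)-f(y)|\le L\|x-y\|$ for all $x,y\in\mathcal X$ (Euclidean norm). Let $\epsilon>0$, and let $x^*\in\mathcal X$ be any global minimizer of $f$ over $\mathcal X$ such that the Euclidean ball $B_{\epsilon/L}(x^*)$ of radius $\epsilon/L$ centred at $x^*$ is contained in $\mathcal X$ (it suffices that the open ball is). Write $f^*=\min_{x\in\mathcal X}f(x)$ and $G_\epsilon=\{x\in\mathcal X: f(x)\le f^*+\epsilon\}$. Let $A$ be a $D\times d$ Gaussian random matrix, that is, a matrix whose entries are independent standard normal random variables, and let $p\in\mathcal X\setminus G_\epsilon$ be a given vector. Set $r_p=\epsilon/(L\|x^*-p\|)$ (the assumptions force $L>0$ and $0<r_p<1$). Then $$\mathbb P\big[\exists\, y\in\mathbb R^d:\ Ay+p\in\mathcal X\ \text{and}\ f(Ay+p)\le f^*+\epsilon\big]\ \ge\ \tau(r_p,d,D),$$ i.e. the random reduced problem $\min_y f(Ay+p)$ subject to $Ay+p\in\mathcal X$ is $\epsilon$-successful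 with probability at least $\tau(r_p,d,D)$. Here, for $0<r<1$ and $1\le d<D$, $$\tau(r,d,D)=\begin{cases}\displaystyle (D-1)\binom{\frac{D-2}{2}}{\frac{D-1}{2}}\int_0^{\arcsin r}\sin^{D-2}(x)\,dx & \text{if } d=1,\\[2mm] \displaystyle \binom{\frac{D-2}{2}}{\frac{D-d}{2}}\,r^{D-d}(1-r^2)^{\frac{d-2}{2}} & \text{if } 1<d<D,\end{cases}$$ where $\displaystyle\binom{i}{j}=\frac{\Gamma(i+1)}{\Gamma(j+1)\,\Gamma(i-j+1)}$ for real $i,j$. -/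

import Mathlib

open MeasureTheory ProbabilityTheory
open scoped NNReal Matrix

noncomputable section

/-- A `D × d` Gaussian random matrix: the entries are independent standard normal variables. -/
structure IsGaussianMatrix {Ω : Type*} [MeasurableSpace Ω] (P : Measure Ω) {D d : ℕ}
    (A : Ω → Matrix (Fin D) (Fin d) ℝ) : Prop where
  hasLaw : ∀ i j, HasLaw (fun ω => A ω i j) (gaussianReal 0 1) P
  indep : iIndepFun (fun (ij : Fin D × Fin d) (ω : Ω) => A ω ij.1 ij.2) P

/-- The optimal value of `f` on the feasible set `X`
(the minimum, as soon as a global minimizer exists). -/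
def optimalValue {D : ℕ} (f : EuclideanSpace ℝ (Fin D) → ℝ)
    (X : Set (EuclideanSpace ℝ (Fin D))) : ℝ :=
  sInf (f '' X)

/-- The set of (feasible) `ε`-minimizers of `f` on `X`. -/
def epsMinimizers {D : ℕ} (f : EuclideanSpace ℝ (Fin D) → ℝ)
    (X : Set (EuclideanSpace ℝ (Fin D))) (ε : ℝ) : Set (EuclideanSpace ℝ (Fin D)) :=
  {x | x ∈ X ∧ f x ≤ optimalValue f X + ε}

/-- The point `A y + p`, as a point of Euclidean space. -/
def embed {D d : ℕ} (A : Matrix (Fin D) (Fin d) ℝ) (p : EuclideanSpace ℝ (Fin D))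
    (y : EuclideanSpace ℝ (Fin d)) : EuclideanSpace ℝ (Fin D) :=
  WithLp.toLp 2 (A *ᵥ y.ofLp) + p

/-- The reduced problem `min f (A y + p)` subject to `A y + p ∈ X` is `ε`-successful. -/
def IsSuccessful {D d : ℕ} (f : EuclideanSpace ℝ (Fin D) → ℝ)
    (X : Set (EuclideanSpace ℝ (Fin D))) (p : EuclideanSpace ℝ (Fin D)) (ε : ℝ)
    (A : Matrix (Fin D) (Fin d) ℝ) : Prop :=
  ∃ y : EuclideanSpace ℝ (Fin d),
    embed A p y ∈ X ∧ f (embed A p y) ≤ optimalValue f X + ε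

/-- The binomial coefficient with real arguments, through the gamma function. -/
def genBinom (i j : ℝ) : ℝ :=
  Real.Gamma (i + 1) / (Real.Gamma (j + 1) * Real.Gamma (i - j + 1))

/-- The function `τ(r, d, D)`, meant for `0 < r < 1` and `1 ≤ d < D`
(so that the subtractions of natural numbers in the exponents are exact). -/
def tau (r : ℝ) (d D : ℕ) : ℝ :=
  if d = 1 then
    ((D : ℝ) - 1) * genBinom (((D : ℝ) - 2) / 2) (((D : ℝ) - 1) / 2) *
      ∫ x in (0 : ℝ)..Real.arcsin r, Real.sin x ^ (D - 2)
  else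
    genBinom (((D : ℝ) - 2) / 2) (((D : ℝ) - (d : ℝ)) / 2) * r ^ (D - d) *
      (1 - r ^ 2) ^ (((d : ℝ) - 2) / 2)

end

/-!
Put `u = x* - p` and `r = ε / (L ‖u‖)`. The problem is successful as soon as `A y + p` falls in the
open ball of radius `ε / L` around `x*`, that is, as soon as the column span of `A` contains a point
at distance less than `r ‖u‖` from `u` (`isSuccessful_of_mem_nearSpan`). It remains to bound the
probability of this event, which depends only on the angle between `u` and a random subspace.

The columns of `A` are independent standard Gaussian vectors of `ℝ^D`
(`IsGaussianMatrix.hasLaw_col`). Their joint law is invariant under linear isometries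
of `ℝ^D` and the event is invariant under scaling of `u`, so the probability does not depend on
`u ≠ 0` (`pi_stdGaussian_nearSpan_eq`). The vector `u` may therefore be replaced by a standard Gaussian
vector `g` independent of `A`, and by Tonelli's theorem one may condition on `A` instead of `g`
(`tau_le_pi_stdGaussian_nearSpan`). Almost surely `A` has rank `d`
(`ae_linearIndependent_pi_stdGaussian`), so what is needed is the Gaussian mass of the cone of
vectors making an angle less than `α = arcsin r` with a fixed `d`-dimensional subspace `V`.

The components of `g` along `V` and `Vᗮ` are independent standard Gaussian vectors
(`stdGaussian_map_orthogonalDecomposition`), and the norm of a standard Gaussian vector of dimension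
`n` has density proportional to `ρ^(n-1) exp(-ρ²/2)` (`stdGaussian_map_norm`). Planar polar
coordinates for the pair of norms show that the mass of the cone is a gamma quotient times
`∫_0^α sin^(D-d-1) θ cos^(d-1) θ dθ` (`le_lintegral_chiDensity_mul`). For `d = 1` this is `τ`; for
`d ≥ 2`, bounding `cos^(d-2) θ` below by `cos^(d-2) α` makes the integral elementary and leaves `τ`
(`tau_le_integral`).
-/

section

open Set Module

/-! ### The standard Gaussian measure: density, norm, orthogonal components -/

section Gaussian

variable {E : Type*} [NormedAddCommGroup E] [InnerProductSpace ℝ E] [FiniteDimensional ℝ E]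
  [MeasurableSpace E] [BorelSpace E]

theorem integrable_exp_neg_norm_sq_div_two :
    Integrable (fun x : E => Real.exp (-‖x‖ ^ 2 / 2)) := by
  have h := GaussianFourier.integrable_cexp_neg_mul_sq_norm_add (V := E) (b := 1 / 2) (by norm_num)
    0 0
  refine (h.re).congr (.of_forall fun x => ?_)
  simp only [zero_mul, add_zero]
  rw [show (-(1 / 2 : ℂ) * (‖x‖ : ℂ) ^ 2) = ((-‖x‖ ^ 2 / 2 : ℝ) : ℂ) by push_cast; ring]
  exact Complex.exp_ofReal_re _

/-- Both sides are finite measures, and they have the same characteristic function. -/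
theorem stdGaussian_eq_withDensity :
    stdGaussian E = volume.withDensity
      (fun x => ENNReal.ofReal
        (Real.exp (-‖x‖ ^ 2 / 2) / (2 * Real.pi) ^ (finrank ℝ E / 2 : ℝ))) := by
  have hint := (integrable_exp_neg_norm_sq_div_two (E := E)).div_const
    ((2 * Real.pi) ^ (finrank ℝ E / 2 : ℝ))
  have : IsFiniteMeasure (volume.withDensity
      (fun x : E => ENNReal.ofReal
        (Real.exp (-‖x‖ ^ 2 / 2) / (2 * Real.pi) ^ (finrank ℝ E / 2 : ℝ)))) :=
    isFiniteMeasure_withDensity_ofReal hint.2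
  apply Measure.ext_of_charFun
  ext t
  rw [charFun_stdGaussian, charFun_apply]
  simp only [ENNReal.ofReal]
  rw [integral_withDensity_eq_integral_smul (by fun_prop)]
  have h := GaussianFourier.integral_cexp_neg_mul_sq_norm_add (V := E) (b := 1 / 2) (by norm_num)
    Complex.I t
  have h2pi : ((Real.pi : ℂ) / (1 / 2)) ^ (finrank ℝ E / 2 : ℂ)
      = (((2 * Real.pi) ^ (finrank ℝ E / 2 : ℝ) : ℝ) : ℂ) := by
    rw [Complex.ofReal_cpow (by positivity)]
    push_cast
    congr 1
    ring
  have hpos : (0 : ℝ) < (2 * Real.pi) ^ (finrank ℝ E / 2 : ℝ) := by positivity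
  have hne : (((2 * Real.pi) ^ (finrank ℝ E / 2 : ℝ) : ℝ) : ℂ) ≠ 0 := by exact_mod_cast hpos.ne'
  set K : ℝ := (2 * Real.pi) ^ (finrank ℝ E / 2 : ℝ)
  rw [h2pi] at h
  have heq : ∀ x : E, (Real.exp (-‖x‖ ^ 2 / 2) / K).toNNReal •
      Complex.exp (inner ℝ x t * Complex.I)
      = (K : ℂ)⁻¹ * Complex.exp (-(1 / 2) * ‖x‖ ^ 2 + Complex.I * inner ℝ t x) := by
    intro x
    rw [NNReal.smul_def, Real.coe_toNNReal _ (by positivity), Complex.exp_add, real_inner_comm,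
      Complex.real_smul]
    push_cast
    ring_nf
  simp_rw [heq]
  rw [integral_const_mul, h, inv_mul_cancel_left₀ hne, Complex.I_sq]
  congr 1
  ring

theorem stdGaussian_absolutelyContinuous : stdGaussian E ≪ volume := by
  rw [stdGaussian_eq_withDensity]
  exact withDensity_absolutelyContinuous _ _

/-- The analogue for the Lebesgue integral of `MeasureTheory.integral_fun_norm_addHaar`. -/
theorem lintegral_fun_norm_addHaar [Nontrivial E] (μ : Measure E) [μ.IsAddHaarMeasure]
    {f : ℝ → ENNReal} (hf : Measurable f) :
    ∫⁻ x, f ‖x‖ ∂μ = μ.toSphere univ *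
      ∫⁻ ρ in Ioi (0 : ℝ), ENNReal.ofReal (ρ ^ (finrank ℝ E - 1)) * f ρ :=
  calc
    ∫⁻ x, f ‖x‖ ∂μ = ∫⁻ x : ({(0)}ᶜ : Set E), f ‖x.1‖ ∂(μ.comap (↑)) := by
      rw [lintegral_subtype_comap (measurableSet_singleton _).compl fun x ↦ f (‖x‖),
        restrict_compl_singleton]
    _ = ∫⁻ x, f x.2 ∂μ.toSphere.prod (.volumeIoiPow (finrank ℝ E - 1)) := by
      simpa using! μ.measurePreserving_homeomorphUnitSphereProd.lintegral_comp_emb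
        (Homeomorph.measurableEmbedding _) (f ∘ Subtype.val ∘ Prod.snd)
    _ = μ.toSphere univ * ∫⁻ x : Ioi (0 : ℝ), f x ∂.volumeIoiPow (finrank ℝ E - 1) := by
      rw [lintegral_prod _ (by fun_prop)]
      simp [mul_comm]
    _ = _ := by
      simp only [Measure.volumeIoiPow]
      rw [lintegral_withDensity_eq_lintegral_mul _ (by fun_prop) (by fun_prop),
        ← lintegral_subtype_comap measurableSet_Ioi]
      rfl

/-- The integral `∫_0^∞ ρ^(n-1) exp(-ρ²/2) dρ`, in closed form. -/
noncomputable def radialMass (n : ℕ) : ℝ := 2 ^ ((n : ℝ) / 2 - 1) * Real.Gamma (n / 2)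

theorem radialMass_pos {n : ℕ} (hn : 0 < n) : 0 < radialMass n := by
  have : 0 < Real.Gamma ((n : ℝ) / 2) := Real.Gamma_pos_of_pos (by positivity)
  unfold radialMass
  positivity

theorem lintegral_pow_mul_exp_neg_sq_div_two {n : ℕ} (hn : 0 < n) :
    ∫⁻ ρ in Ioi (0 : ℝ), ENNReal.ofReal (ρ ^ (n - 1) * Real.exp (-ρ ^ 2 / 2))
      = ENNReal.ofReal (radialMass n) := by
  have hn' : (1 : ℝ) ≤ n := by exact_mod_cast hn
  have hcongr : ∀ ρ ∈ Ioi (0 : ℝ), ρ ^ ((n : ℝ) - 1) * Real.exp (-(1 / 2) * ρ ^ (2 : ℝ))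
      = ρ ^ (n - 1) * Real.exp (-ρ ^ 2 / 2) := by
    intro ρ _
    rw [show ((n : ℝ) - 1) = ((n - 1 : ℕ) : ℝ) by rw [Nat.cast_sub hn]; simp,
      Real.rpow_natCast, Real.rpow_two]
    congr 2
    ring
  have hval : ∫ ρ in Ioi (0 : ℝ), ρ ^ (n - 1) * Real.exp (-ρ ^ 2 / 2) = radialMass n := by
    rw [← setIntegral_congr_fun measurableSet_Ioi hcongr,
      integral_rpow_mul_exp_neg_mul_rpow (by norm_num) (by linarith) (by norm_num), radialMass]
    rw [show (1 / 2 : ℝ) = 2⁻¹ by norm_num, Real.inv_rpow (by norm_num),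
      ← Real.rpow_neg (by norm_num),
      Real.rpow_sub (by norm_num), Real.rpow_one]
    ring_nf
  have hint : IntegrableOn (fun ρ : ℝ => ρ ^ (n - 1) * Real.exp (-ρ ^ 2 / 2)) (Ioi 0) := by
    -- the integral of a non-integrable function would be zero
    by_contra h
    exact (radialMass_pos hn).ne' (hval ▸ integral_undef h)
  rw [← hval, ofReal_integral_eq_lintegral_ofReal hint]
  filter_upwards [self_mem_ae_restrict measurableSet_Ioi] with ρ hρ
  have : (0 : ℝ) < ρ := hρ
  simp only [Pi.zero_apply]
  positivity

/-- The density on `(0, ∞)` of the norm of a standard Gaussian vector of dimension `n`. -/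
noncomputable def chiDensity (n : ℕ) (ρ : ℝ) : ℝ :=
  ρ ^ (n - 1) * Real.exp (-ρ ^ 2 / 2) / radialMass n

@[fun_prop]
theorem measurable_chiDensity (n : ℕ) : Measurable (chiDensity n) := by
  unfold chiDensity
  fun_prop

/-- The normalizing constant comes for free: the law of the norm is proportional to
`ρ^(n-1) exp(-ρ²/2)`, and it has total mass one. -/
theorem stdGaussian_map_norm [Nontrivial E] :
    (stdGaussian E).map (fun x => ‖x‖) =
      (volume.restrict (Ioi 0)).withDensity
        (fun ρ => ENNReal.ofReal (chiDensity (finrank ℝ E) ρ)) := by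
  have hn : 0 < finrank ℝ E := finrank_pos
  set n := finrank ℝ E with hndef
  have hJ := radialMass_pos hn
  set w : ℝ → ENNReal := fun ρ => ENNReal.ofReal (ρ ^ (n - 1) * Real.exp (-ρ ^ 2 / 2)) with hw
  set K : ℝ := (2 * Real.pi) ^ (n / 2 : ℝ)
  have hK : 0 < K := by positivity
  have hmeas : Measurable w := by fun_prop
  obtain ⟨c, hc⟩ : ∃ c : ENNReal, (stdGaussian E).map (fun x => ‖x‖) =
      c • (volume.restrict (Ioi 0)).withDensity w := by
    refine ⟨(volume : Measure E).toSphere univ * ENNReal.ofReal K⁻¹, ?_⟩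
    ext s hs
    rw [Measure.map_apply measurable_norm hs, stdGaussian_eq_withDensity,
      withDensity_apply _ (measurable_norm hs), ← lintegral_indicator (measurable_norm hs),
      Measure.smul_apply, withDensity_apply _ hs, ← lintegral_indicator hs]
    have := lintegral_fun_norm_addHaar (volume : Measure E)
      (f := s.indicator fun ρ => ENNReal.ofReal (Real.exp (-ρ ^ 2 / 2) / K))
      (Measurable.indicator (by fun_prop) hs)
    refine Eq.trans ?_ (this.trans ?_)
    · rfl
    · rw [smul_eq_mul, mul_assoc, ← lintegral_const_mul _ (hmeas.indicator hs)]
      congr 1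
      refine setLIntegral_congr_fun measurableSet_Ioi fun ρ hρ => ?_
      have hρ' : (0 : ℝ) < ρ := hρ
      by_cases h : ρ ∈ s
      · simp only [h, indicator_of_mem, hw]
        rw [← ENNReal.ofReal_mul (by positivity), ← ENNReal.ofReal_mul (by positivity)]
        congr 1
        ring
      · simp [h]
  have htot := congrArg (fun m => m univ) hc
  have hprob : IsProbabilityMeasure ((stdGaussian E).map (fun x => ‖x‖)) :=
    Measure.isProbabilityMeasure_map (by fun_prop)
  simp only [measure_univ, Measure.smul_apply, withDensity_apply _ MeasurableSet.univ,
    Measure.restrict_univ, smul_eq_mul] at htot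
  rw [hw, lintegral_pow_mul_exp_neg_sq_div_two hn] at htot
  have hc' : c = ENNReal.ofReal (radialMass n)⁻¹ := by
    rw [ENNReal.ofReal_inv_of_pos hJ]
    exact ENNReal.eq_inv_of_mul_eq_one_left htot.symm
  rw [hc, hc', ← withDensity_smul _ hmeas]
  congr 1
  ext ρ
  simp only [Pi.smul_apply, smul_eq_mul, hw, chiDensity]
  rw [← ENNReal.ofReal_mul (by positivity)]
  congr 1
  ring

/-- The components of a standard Gaussian vector along a subspace and along its orthogonal
complement are independent standard Gaussian vectors. -/
theorem stdGaussian_map_orthogonalDecomposition (V : Submodule ℝ E) :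
    (stdGaussian E).map (fun x => (V.orthogonalProjectionOnto x, Vᗮ.orthogonalProjectionOnto x))
      = (stdGaussian V).prod (stdGaussian Vᗮ) := by
  have h1 : ((stdGaussian V).prod (stdGaussian Vᗮ)).map (WithLp.toLp 2)
      = stdGaussian (WithLp 2 (V × Vᗮ)) := by
    have : IsProbabilityMeasure
        (((stdGaussian V).prod (stdGaussian Vᗮ)).map (WithLp.toLp 2)) :=
      Measure.isProbabilityMeasure_map (by fun_prop)
    apply Measure.ext_of_charFun
    ext t
    rw [charFun_prod, charFun_stdGaussian, charFun_stdGaussian, charFun_stdGaussian,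
      ← Complex.exp_add, ← Complex.ofReal_pow ‖t‖, WithLp.prod_norm_sq_eq_of_L2]
    congr 1
    simp only [WithLp.fst, WithLp.snd]
    push_cast
    ring
  have h2 := stdGaussian_map (E := E) V.orthogonalDecomposition
  rw [← h1] at h2
  have h3 := congrArg (Measure.map (WithLp.ofLp)) h2
  rw [Measure.map_map (by fun_prop) (by fun_prop),
    Measure.map_map (by fun_prop) (by fun_prop)] at h3
  have e1 : (WithLp.ofLp ∘ WithLp.toLp 2 : V × Vᗮ → V × Vᗮ) = id := rfl
  rw [e1, Measure.map_id] at h3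
  rw [← h3]
  congr 1
  ext x <;> simp

/-- The standard Gaussian mass of a cone around a subspace, as a planar integral. -/
theorem stdGaussian_setOf_norm_lt [Nontrivial E] (V : Submodule ℝ E) (hV : V ≠ ⊥)
    (hV' : Vᗮ ≠ ⊥) (κ : ℝ) :
    stdGaussian E {x | ‖Vᗮ.orthogonalProjectionOnto x‖ < κ * ‖V.orthogonalProjectionOnto x‖} =
      ∫⁻ z in (Ioi (0 : ℝ) ×ˢ Ioi (0 : ℝ)) ∩ {z | z.2 < κ * z.1},
        ENNReal.ofReal (chiDensity (finrank ℝ V) z.1 * chiDensity (finrank ℝ Vᗮ) z.2) := by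
  have : Nontrivial V := V.nontrivial_iff_ne_bot.2 hV
  have : Nontrivial Vᗮ := Vᗮ.nontrivial_iff_ne_bot.2 hV'
  have hT : MeasurableSet {z : ℝ × ℝ | z.2 < κ * z.1} :=
    measurableSet_lt (by fun_prop) (by fun_prop)
  have hT' : MeasurableSet {z : V × Vᗮ | ‖z.2‖ < κ * ‖z.1‖} :=
    measurableSet_lt (by fun_prop) (by fun_prop)
  have h1 : stdGaussian E
        {x | ‖Vᗮ.orthogonalProjectionOnto x‖ < κ * ‖V.orthogonalProjectionOnto x‖}
      = ((stdGaussian V).prod (stdGaussian Vᗮ)) {z | ‖z.2‖ < κ * ‖z.1‖} := by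
    rw [← stdGaussian_map_orthogonalDecomposition, Measure.map_apply (by fun_prop) hT']
    rfl
  have h2 : ((stdGaussian V).prod (stdGaussian Vᗮ)) {z | ‖z.2‖ < κ * ‖z.1‖}
      = (((stdGaussian V).map (fun x => ‖x‖)).prod ((stdGaussian Vᗮ).map (fun x => ‖x‖)))
        {z | z.2 < κ * z.1} := by
    rw [Measure.map_prod_map _ _ (by fun_prop) (by fun_prop), Measure.map_apply (by fun_prop) hT]
    rfl
  rw [h1, h2, stdGaussian_map_norm, stdGaussian_map_norm,
    prod_withDensity (by fun_prop) (by fun_prop), Measure.prod_restrict,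
    withDensity_apply _ hT, Measure.restrict_restrict hT, inter_comm, ← Measure.volume_eq_prod]
  refine setLIntegral_congr_fun ((measurableSet_Ioi.prod measurableSet_Ioi).inter hT)
    fun z hz => ?_
  rw [← ENNReal.ofReal_mul]
  have : (0 : ℝ) < z.1 := hz.1.1
  have := radialMass_pos (finrank_pos (R := ℝ) (M := V))
  unfold chiDensity
  positivity

end Gaussian

/-! ### The angular integral and `τ` -/

section Angle

/-- Polar coordinates factor the planar integral into a radial mass and an angular integral. Only
this inequality is needed, so only the inclusion of the sector `0 < θ < α` in the domain is
verified. -/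
theorem le_lintegral_chiDensity_mul {d m : ℕ} (hd : 0 < d) (hm : 0 < m) {α : ℝ} (hα : 0 < α)
    (hα' : α < Real.pi / 2) :
    ENNReal.ofReal (radialMass (d + m) / (radialMass d * radialMass m) *
        ∫ θ in (0 : ℝ)..α, Real.sin θ ^ (m - 1) * Real.cos θ ^ (d - 1)) ≤
      ∫⁻ z in (Ioi (0 : ℝ) ×ˢ Ioi (0 : ℝ)) ∩ {z | z.2 < Real.tan α * z.1},
        ENNReal.ofReal (chiDensity d z.1 * chiDensity m z.2) := by
  have hJd := radialMass_pos hd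
  have hJm := radialMass_pos hm
  have hJ := radialMass_pos (Nat.add_pos_left hd m)
  have hsc : ∀ θ ∈ Ioo (0 : ℝ) α, 0 < Real.sin θ ∧ 0 < Real.cos θ := fun θ hθ =>
    ⟨Real.sin_pos_of_pos_of_lt_pi hθ.1 (by linarith [hθ.2, Real.pi_pos]),
      Real.cos_pos_of_mem_Ioo ⟨by linarith [hθ.1, Real.pi_pos], by linarith [hθ.2]⟩⟩
  have hT : MeasurableSet ((Ioi (0 : ℝ) ×ˢ Ioi (0 : ℝ)) ∩ {z : ℝ × ℝ | z.2 < Real.tan α * z.1}) :=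
    (measurableSet_Ioi.prod measurableSet_Ioi).inter
      (measurableSet_lt (by fun_prop) (by fun_prop))
  set g : ℝ → ℝ := fun θ => Real.sin θ ^ (m - 1) * Real.cos θ ^ (d - 1) with hg
  have hgint : ENNReal.ofReal (∫ θ in (0 : ℝ)..α, g θ) =
      ∫⁻ θ in Ioo (0 : ℝ) α, ENNReal.ofReal (g θ) := by
    have hcont : Continuous g := by fun_prop
    rw [intervalIntegral.integral_of_le hα.le, integral_Ioc_eq_integral_Ioo,
      ofReal_integral_eq_lintegral_ofReal]
    · exact (hcont.integrableOn_Icc (a := 0) (b := α)).mono_set Ioo_subset_Icc_self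
    · filter_upwards [self_mem_ae_restrict measurableSet_Ioo] with θ hθ
      obtain ⟨hs, hc⟩ := hsc θ hθ
      simp only [Pi.zero_apply, hg]
      positivity
  rw [← lintegral_indicator hT, ← lintegral_comp_polarCoord_symm]
  calc
    _ = ∫⁻ p in Ioi (0 : ℝ) ×ˢ Ioo (0 : ℝ) α,
          ENNReal.ofReal (p.1 ^ (d + m - 1) * Real.exp (-p.1 ^ 2 / 2)) *
            (ENNReal.ofReal (radialMass d * radialMass m)⁻¹ * ENNReal.ofReal (g p.2)) := by
      rw [Measure.volume_eq_prod, ← Measure.prod_restrict, lintegral_prod_mul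
        (f := fun ρ => ENNReal.ofReal (ρ ^ (d + m - 1) * Real.exp (-ρ ^ 2 / 2)))
        (g := fun θ => ENNReal.ofReal (radialMass d * radialMass m)⁻¹ * ENNReal.ofReal (g θ))
        (by fun_prop) (by fun_prop), lintegral_const_mul _ (by fun_prop), ← hgint,
        lintegral_pow_mul_exp_neg_sq_div_two (Nat.add_pos_left hd m),
        ← ENNReal.ofReal_mul (by positivity), ← ENNReal.ofReal_mul (by positivity)]
      congr 1
      ring
    _ = ∫⁻ p in Ioi (0 : ℝ) ×ˢ Ioo (0 : ℝ) α, ENNReal.ofReal p.1 •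
          ((Ioi (0 : ℝ) ×ˢ Ioi (0 : ℝ)) ∩ {z : ℝ × ℝ | z.2 < Real.tan α * z.1}).indicator
            (fun z => ENNReal.ofReal (chiDensity d z.1 * chiDensity m z.2))
            (polarCoord.symm p) := by
      refine setLIntegral_congr_fun (measurableSet_Ioi.prod measurableSet_Ioo) fun p hp => ?_
      obtain ⟨ρ, θ⟩ := p
      have hρ : 0 < ρ := hp.1
      have hθ : θ ∈ Ioo 0 α := hp.2
      obtain ⟨hs, hc⟩ := hsc θ hθ
      have hcα : 0 < Real.cos α :=
        Real.cos_pos_of_mem_Ioo ⟨by linarith [Real.pi_pos], hα'⟩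
      have hmem : polarCoord.symm (ρ, θ) ∈
          (Ioi (0 : ℝ) ×ˢ Ioi (0 : ℝ)) ∩ {z : ℝ × ℝ | z.2 < Real.tan α * z.1} := by
        refine ⟨⟨by simp only [polarCoord_symm_apply]; exact mul_pos hρ hc,
          by simp only [polarCoord_symm_apply]; exact mul_pos hρ hs⟩, ?_⟩
        change ρ * Real.sin θ < Real.tan α * (ρ * Real.cos θ)
        have h := Real.sin_pos_of_pos_of_lt_pi (x := α - θ) (by linarith [hθ.2])
          (by linarith [hθ.1, Real.pi_pos])
        rw [Real.sin_sub] at h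
        rw [Real.tan_eq_sin_div_cos, div_mul_eq_mul_div, lt_div_iff₀ hcα]
        nlinarith
      rw [indicator_of_mem hmem]
      simp only [polarCoord_symm_apply, smul_eq_mul]
      rw [← ENNReal.ofReal_mul (by positivity), ← ENNReal.ofReal_mul (by positivity),
        ← ENNReal.ofReal_mul hρ.le]
      congr 1
      have hexp : Real.exp (-ρ ^ 2 / 2) = Real.exp (-(ρ * Real.cos θ) ^ 2 / 2) *
          Real.exp (-(ρ * Real.sin θ) ^ 2 / 2) := by
        rw [← Real.exp_add]
        congr 1
        linear_combination (ρ ^ 2 / 2) * Real.sin_sq_add_cos_sq θ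
      simp only [chiDensity, hg, hexp]
      obtain ⟨d, rfl⟩ := Nat.exists_eq_add_of_lt hd
      obtain ⟨m, rfl⟩ := Nat.exists_eq_add_of_lt hm
      simp only [zero_add, Nat.add_sub_cancel, show d + 1 + (m + 1) - 1 = d + m + 1 by omega] at *
      field_simp
      ring
    _ ≤ _ := lintegral_mono_set (prod_mono_right (Ioo_subset_Ioo (by linarith [Real.pi_pos])
          (by linarith [Real.pi_pos])))

theorem radialMass_div_eq {d D : ℕ} (hd : 0 < d) (hdD : d < D) :
    radialMass D / (radialMass d * radialMass (D - d)) =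
      2 * Real.Gamma (D / 2) / (Real.Gamma (d / 2) * Real.Gamma (((D : ℝ) - d) / 2)) := by
  have h1 := Real.Gamma_pos_of_pos (s := (d : ℝ) / 2) (by positivity)
  have hdD' : (0 : ℝ) < (D : ℝ) - d := by
    have : (d : ℝ) < D := by exact_mod_cast hdD
    linarith
  have h2 := Real.Gamma_pos_of_pos (s := ((D : ℝ) - d) / 2) (by positivity)
  have hpow : (2 : ℝ) ^ ((D : ℝ) / 2 - 1) =
      2 * (2 ^ ((d : ℝ) / 2 - 1) * 2 ^ (((D : ℝ) - d) / 2 - 1)) := by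
    rw [show (D : ℝ) / 2 - 1 = 1 + ((d : ℝ) / 2 - 1 + (((D : ℝ) - d) / 2 - 1)) by ring,
      Real.rpow_add two_pos, Real.rpow_add two_pos, Real.rpow_one]
  unfold radialMass
  rw [Nat.cast_sub hdD.le, hpow]
  field_simp

/-- The right-hand side is the probability that a random `d`-dimensional subspace makes an angle
less than `arcsin r` with a given line. There is equality for `d = 1`; for `d ≥ 2` the loss is the
bound `cos (arcsin r) ≤ cos θ` applied to `d - 2` of the factors `cos θ`. -/
theorem tau_le_integral {d D : ℕ} (hd : 1 ≤ d) (hdD : d < D) {r : ℝ} (hr : 0 < r) (hr' : r < 1) :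
    tau r d D ≤ radialMass D / (radialMass d * radialMass (D - d)) *
      ∫ θ in (0 : ℝ)..Real.arcsin r, Real.sin θ ^ (D - d - 1) * Real.cos θ ^ (d - 1) := by
  have hD : (d : ℝ) + 1 ≤ D := by exact_mod_cast hdD
  rw [radialMass_div_eq hd hdD]
  have hd' : (1 : ℝ) ≤ d := by exact_mod_cast hd
  set a : ℝ := ((D : ℝ) - d) / 2 with ha
  have ha0 : 0 < a := by rw [ha]; linarith
  have hΓa := Real.Gamma_pos_of_pos ha0
  have hΓd := Real.Gamma_pos_of_pos (s := (d : ℝ) / 2) (by positivity)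
  have hΓD := Real.Gamma_pos_of_pos (s := (D : ℝ) / 2) (by linarith)
  have hΓa1 : Real.Gamma (a + 1) = a * Real.Gamma a := Real.Gamma_add_one ha0.ne'
  -- both branches of `tau` involve the same quotient of gamma values
  have hbinom : genBinom (((D : ℝ) - 2) / 2) a =
      Real.Gamma (D / 2) / (a * Real.Gamma a * Real.Gamma (d / 2)) := by
    rw [genBinom, hΓa1, show ((D : ℝ) - 2) / 2 + 1 = D / 2 by ring,
      show ((D : ℝ) - 2) / 2 - a + 1 = d / 2 by rw [ha]; ring]
  unfold tau
  split_ifs with h1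
  · subst h1
    rw [Nat.cast_one] at ha
    rw [← ha, hbinom, show D - 1 - 1 = D - 2 by omega]
    simp only [Nat.sub_self, pow_zero, mul_one]
    refine le_of_eq ?_
    congr 1
    rw [show (D : ℝ) - 1 = 2 * a by rw [ha]; ring]
    field_simp
  · have h2 : 2 ≤ d := by omega
    have h2' : (2 : ℝ) ≤ d := by exact_mod_cast h2
    rw [hbinom]
    set α := Real.arcsin r with hαdef
    have hα : 0 < α := Real.arcsin_pos.2 hr
    have hα' : α < Real.pi / 2 := Real.arcsin_lt_pi_div_two.2 hr'
    have hsin : Real.sin α = r := Real.sin_arcsin (by linarith) hr'.le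
    have hcos : 0 < Real.cos α := Real.cos_pos_of_mem_Ioo ⟨by linarith [Real.pi_pos], hα'⟩
    have hcosr : (1 - r ^ 2) ^ (((d : ℝ) - 2) / 2) = Real.cos α ^ (d - 2) := by
      rw [← hsin, ← Real.cos_sq', ← Real.rpow_natCast (Real.cos α) 2, ← Real.rpow_mul hcos.le,
        ← Real.rpow_natCast, Nat.cast_sub h2]
      congr 1
      push_cast
      ring
    -- an explicit primitive, available because one factor `cos θ` is kept
    have hprim : ∫ θ in (0 : ℝ)..α, Real.sin θ ^ (D - d - 1) * Real.cos θ
        = r ^ (D - d) / (2 * a) := by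
      have hcast : (((D - d - 1 : ℕ) : ℝ) + 1) = 2 * a := by
        rw [ha, Nat.sub_sub, Nat.cast_sub (by omega)]
        push_cast
        ring
      have := integral_sin_pow_mul_cos_pow_odd (a := 0) (b := α) (D - d - 1) 0
      simp only [mul_zero, zero_add, pow_one, pow_zero, mul_one, Real.sin_zero, integral_pow,
        hsin, hcast] at this
      rw [this, show D - d - 1 + 1 = D - d by omega, zero_pow (by omega), sub_zero]
    have hlower : Real.cos α ^ (d - 2) * (r ^ (D - d) / (2 * a)) ≤
        ∫ θ in (0 : ℝ)..α, Real.sin θ ^ (D - d - 1) * Real.cos θ ^ (d - 1) := by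
      rw [← hprim, ← intervalIntegral.integral_const_mul]
      refine intervalIntegral.integral_mono_on hα.le
        (Continuous.intervalIntegrable (by fun_prop) _ _)
        (Continuous.intervalIntegrable (by fun_prop) _ _) fun θ hθ => ?_
      have hs : 0 ≤ Real.sin θ :=
        Real.sin_nonneg_of_nonneg_of_le_pi hθ.1 (by linarith [hθ.2, Real.pi_pos])
      have hc : Real.cos α ≤ Real.cos θ :=
        Real.cos_le_cos_of_nonneg_of_le_pi hθ.1 (by linarith) hθ.2
      have hc0 : 0 ≤ Real.cos θ := hcos.le.trans hc
      rw [show d - 1 = d - 2 + 1 by omega, pow_succ]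
      calc Real.cos α ^ (d - 2) * (Real.sin θ ^ (D - d - 1) * Real.cos θ)
          ≤ Real.cos θ ^ (d - 2) * (Real.sin θ ^ (D - d - 1) * Real.cos θ) := by gcongr
        _ = _ := by ring
    rw [hcosr]
    refine le_trans (le_of_eq ?_) (mul_le_mul_of_nonneg_left hlower (by positivity))
    field_simp

end Angle

/-! ### Proximity of a vector to the span of a family -/

section NearSpan

variable {E : Type*} [NormedAddCommGroup E] [InnerProductSpace ℝ E]

/-- The pairs `(v, u)` for which the span of the family `v` meets the open ball of radius
`r * ‖u‖` around `u`. -/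
def nearSpan (d : ℕ) (r : ℝ) : Set ((Fin d → E) × E) :=
  {q | ∃ y : Fin d → ℝ, ‖∑ j, y j • q.1 j - q.2‖ < r * ‖q.2‖}

theorem isOpen_nearSpan (d : ℕ) (r : ℝ) : IsOpen (nearSpan (E := E) d r) := by
  have : nearSpan (E := E) d r =
      ⋃ y : Fin d → ℝ, {q | ‖∑ j, y j • q.1 j - q.2‖ < r * ‖q.2‖} := by
    ext q
    simp [nearSpan]
  rw [this]
  exact isOpen_iUnion fun y => isOpen_lt (by fun_prop) (by fun_prop)

theorem map_mem_nearSpan_iff {d : ℕ} {r : ℝ} (Q : E ≃ₗᵢ[ℝ] E) (v : Fin d → E) (u : E) :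
    (fun j => Q (v j), Q u) ∈ nearSpan d r ↔ (v, u) ∈ nearSpan d r := by
  have h : ∀ y : Fin d → ℝ, ∑ j, y j • Q (v j) - Q u = Q (∑ j, y j • v j - u) := by
    intro y
    simp
  simp only [nearSpan, mem_ofPred_eq, h, LinearIsometryEquiv.norm_map]

theorem mem_nearSpan_of_smul {d : ℕ} {r c : ℝ} (hc : 0 < c) {v : Fin d → E} {u : E}
    (h : (v, c • u) ∈ nearSpan d r) : (v, u) ∈ nearSpan d r := by
  obtain ⟨y, hy⟩ := h
  refine ⟨c⁻¹ • y, ?_⟩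
  have h1 : ∑ j, (c⁻¹ • y) j • v j - u = c⁻¹ • (∑ j, y j • v j - c • u) := by
    simp [smul_sub, Finset.smul_sum, smul_smul, hc.ne']
  simp only [h1, norm_smul, Real.norm_eq_abs, abs_inv, abs_of_pos hc] at hy ⊢
  rw [inv_mul_lt_iff₀ hc]
  linarith

theorem smul_mem_nearSpan_iff {d : ℕ} {r c : ℝ} (hc : 0 < c) {v : Fin d → E} {u : E} :
    (v, c • u) ∈ nearSpan d r ↔ (v, u) ∈ nearSpan d r := by
  refine ⟨mem_nearSpan_of_smul hc, fun h => mem_nearSpan_of_smul (inv_pos.2 hc) ?_⟩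
  rwa [smul_smul, inv_mul_cancel₀ hc.ne', one_smul]

end NearSpan

/-! ### The span of independent Gaussian vectors -/

section RandomSubspace

variable {E : Type*} [NormedAddCommGroup E] [InnerProductSpace ℝ E] [FiniteDimensional ℝ E]
  [MeasurableSpace E] [BorelSpace E]

/-- By induction on `d`: a new vector almost surely avoids the proper subspace spanned by the
previous ones. -/
theorem ae_linearIndependent_pi_stdGaussian (d : ℕ) (hd : d ≤ finrank ℝ E) :
    ∀ᵐ v ∂(Measure.pi fun _ : Fin d => stdGaussian E), LinearIndependent ℝ v := by
  induction d with
  | zero => exact .of_forall fun v => linearIndependent_empty_type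
  | succ d ih =>
    have ih := ih (by omega)
    set P := Measure.pi fun _ : Fin d => stdGaussian E
    have hopen : IsOpen {v : Fin (d + 1) → E | LinearIndependent ℝ v} :=
      isOpen_setOfPred_linearIndependent
    have hmp := (measurePreserving_piFinSuccAbove (fun _ : Fin (d + 1) => stdGaussian E) 0).symm
    rw [← hmp.map_eq, ae_map_iff hmp.measurable.aemeasurable hopen.measurableSet]
    have hset : MeasurableSet {q : E × (Fin d → E) |
        ¬ LinearIndependent ℝ ((MeasurableEquiv.piFinSuccAbove (fun _ => E) 0).symm q)} :=
      (hmp.measurable hopen.measurableSet).compl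
    rw [ae_iff, Measure.prod_apply_symm hset, lintegral_eq_zero_iff
      (measurable_measure_prodMk_right hset)]
    filter_upwards [ih] with v hv
    have hlt : Submodule.span ℝ (range v) ≠ ⊤ := by
      intro h
      have h1 := finrank_span_eq_card hv
      rw [h, finrank_top, Fintype.card_fin] at h1
      omega
    refine measure_mono_null ?_
      (stdGaussian_absolutelyContinuous (Measure.addHaar_submodule volume _ hlt))
    intro x hx
    by_contra hxv
    refine hx ?_
    change LinearIndependent ℝ (Fin.insertNth 0 x v)
    rw [Fin.insertNth_zero']
    exact linearIndependent_finCons.2 ⟨hv, hxv⟩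

/-- A linear isometry and a scaling carry any nonzero target to any other one, and neither changes
the probability of coming near it. -/
theorem pi_stdGaussian_nearSpan_eq (d : ℕ) (r : ℝ) {u u' : E} (hu : u ≠ 0) (hu' : u' ≠ 0) :
    (Measure.pi fun _ : Fin d => stdGaussian E) {v | (v, u) ∈ nearSpan d r} =
      (Measure.pi fun _ : Fin d => stdGaussian E) {v | (v, u') ∈ nearSpan d r} := by
  have hu0 := norm_pos_iff.2 hu
  have hu0' := norm_pos_iff.2 hu'
  have hc : 0 < ‖u‖ / ‖u'‖ := div_pos hu0 hu0'
  set c := ‖u‖ / ‖u'‖ with hcdef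
  have hnorm : ‖u‖ = ‖c • u'‖ := by
    rw [norm_smul, Real.norm_of_nonneg hc.le, hcdef, div_mul_cancel₀ _ hu0'.ne']
  -- the reflection exchanging two vectors of equal norm
  obtain ⟨Q, hQ⟩ : ∃ Q : E ≃ₗᵢ[ℝ] E, Q u = c • u' :=
    ⟨_, Submodule.reflection_sub hnorm⟩
  have hmp : MeasurePreserving (fun (v : Fin d → E) j => Q (v j))
      (Measure.pi fun _ : Fin d => stdGaussian E) (Measure.pi fun _ : Fin d => stdGaussian E) :=
    measurePreserving_pi _ _ fun _ => ⟨Q.continuous.measurable, stdGaussian_map Q⟩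
  have hmeas : MeasurableSet {v : Fin d → E | (v, u') ∈ nearSpan d r} :=
    ((isOpen_nearSpan d r).preimage
      (by fun_prop : Continuous fun v : Fin d → E => (v, u'))).measurableSet
  rw [← hmp.measure_preimage hmeas.nullMeasurableSet]
  congr 1
  ext v
  change (v, u) ∈ nearSpan d r ↔ (fun j => Q (v j), u') ∈ nearSpan d r
  rw [← map_mem_nearSpan_iff Q, hQ, smul_mem_nearSpan_iff hc]

/-- The subspace is fixed here and the target is Gaussian: the bound is the mass of the cone of
half-angle `arcsin r` around the span of `v`. -/
theorem tau_le_stdGaussian_nearSpan {d : ℕ} (hd : 1 ≤ d) (hdE : d < finrank ℝ E) {r : ℝ}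
    (hr : 0 < r) (hr' : r < 1) {v : Fin d → E} (hv : LinearIndependent ℝ v) :
    ENNReal.ofReal (tau r d (finrank ℝ E)) ≤ stdGaussian E {g | (v, g) ∈ nearSpan d r} := by
  have : Nontrivial E := Module.finrank_pos_iff (R := ℝ) |>.1 (by omega)
  set V := Submodule.span ℝ (range v)
  have hV : finrank ℝ V = d := by
    rw [finrank_span_eq_card hv, Fintype.card_fin]
  have hV' : finrank ℝ Vᗮ = finrank ℝ E - d := by
    have := V.finrank_add_finrank_orthogonal
    omega
  have hVne : V ≠ ⊥ := by
    intro h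
    rw [h, finrank_bot] at hV
    omega
  have hVne' : Vᗮ ≠ ⊥ := by
    intro h
    rw [h, finrank_bot] at hV'
    omega
  have hα : 0 < Real.arcsin r := Real.arcsin_pos.2 hr
  have hα' : Real.arcsin r < Real.pi / 2 := Real.arcsin_lt_pi_div_two.2 hr'
  have hcos : 0 < Real.cos (Real.arcsin r) :=
    Real.cos_pos_of_mem_Ioo ⟨by linarith [Real.pi_pos], hα'⟩
  have hsin : Real.sin (Real.arcsin r) = r := Real.sin_arcsin (by linarith) hr'.le
  have hangle := le_lintegral_chiDensity_mul (d := d) (m := finrank ℝ E - d) hd (by omega) hα hα'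
  rw [show d + (finrank ℝ E - d) = finrank ℝ E by omega] at hangle
  calc
    _ ≤ stdGaussian E {x | ‖Vᗮ.orthogonalProjectionOnto x‖ <
          Real.tan (Real.arcsin r) * ‖V.orthogonalProjectionOnto x‖} := by
      rw [stdGaussian_setOf_norm_lt V hVne hVne', hV, hV']
      exact (ENNReal.ofReal_le_ofReal (tau_le_integral hd hdE hr hr')).trans hangle
    _ ≤ _ := by
      refine measure_mono fun g hg => ?_
      obtain ⟨y, hy⟩ := (Submodule.mem_span_range_iff_exists_fun ℝ).1
        (V.orthogonalProjectionOnto g).2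
      refine ⟨y, ?_⟩
      have hdecomp : (V.orthogonalProjectionOnto g : E) - g =
          -(Vᗮ.orthogonalProjectionOnto g : E) := by
        have := V.starProjection_add_starProjection_orthogonal g
        simp only [Submodule.starProjection_apply] at this
        nth_rewrite 2 [← this]
        abel
      have hpyth := V.norm_sq_eq_add_norm_sq_projection g
      simp only [hy, hdecomp, norm_neg]
      simp only [mem_ofPred_eq] at hg
      have ha : 0 ≤ ‖Vᗮ.orthogonalProjectionOnto g‖ := norm_nonneg _
      have hb : 0 ≤ ‖V.orthogonalProjectionOnto g‖ := norm_nonneg _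
      simp only [← Submodule.coe_norm] at *
      -- `a < tan α * b` amounts to `a < sin α * √(a² + b²)`, where `a² + b² = ‖g‖²`
      set a := ‖Vᗮ.orthogonalProjectionOnto g‖
      set b := ‖V.orthogonalProjectionOnto g‖
      rw [Real.tan_eq_sin_div_cos, div_mul_eq_mul_div, lt_div_iff₀ hcos, hsin] at hg
      have hcs := Real.sin_sq_add_cos_sq (Real.arcsin r)
      rw [hsin] at hcs
      have hsq : (a * Real.cos (Real.arcsin r)) ^ 2 < (r * b) ^ 2 :=
        pow_lt_pow_left₀ hg (by positivity) two_ne_zero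
      refine lt_of_pow_lt_pow_left₀ 2 (by positivity) ?_
      rw [mul_pow, hpyth]
      have : a ^ 2 = a ^ 2 * (r ^ 2 + Real.cos (Real.arcsin r) ^ 2) := by rw [hcs, mul_one]
      nlinarith

/-- By `pi_stdGaussian_nearSpan_eq` the fixed target may be replaced by an independent Gaussian
vector; exchanging the order of integration then fixes the subspace instead. -/
theorem tau_le_pi_stdGaussian_nearSpan {d : ℕ} (hd : 1 ≤ d) (hdE : d < finrank ℝ E) {r : ℝ}
    (hr : 0 < r) (hr' : r < 1) {u : E} (hu : u ≠ 0) :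
    ENNReal.ofReal (tau r d (finrank ℝ E)) ≤
      (Measure.pi fun _ : Fin d => stdGaussian E) {v | (v, u) ∈ nearSpan d r} := by
  have : Nontrivial E := Module.finrank_pos_iff (R := ℝ) |>.1 (by omega)
  set P := Measure.pi fun _ : Fin d => stdGaussian E
  have hS : MeasurableSet (nearSpan (E := E) d r) := (isOpen_nearSpan d r).measurableSet
  have hne : ∀ᵐ g ∂(stdGaussian E), g ≠ 0 :=
    stdGaussian_absolutelyContinuous.ae_le (Measure.ae_ne volume 0)
  calc
    _ = ∫⁻ _ : Fin d → E, ENNReal.ofReal (tau r d (finrank ℝ E)) ∂P := by simp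
    _ ≤ ∫⁻ v, stdGaussian E {g | (v, g) ∈ nearSpan d r} ∂P := by
      refine lintegral_mono_ae ?_
      filter_upwards [ae_linearIndependent_pi_stdGaussian (E := E) d hdE.le] with v hv
      exact tau_le_stdGaussian_nearSpan hd hdE hr hr' hv
    _ = (P.prod (stdGaussian E)) (nearSpan d r) := (Measure.prod_apply hS).symm
    _ = ∫⁻ g, P {v | (v, g) ∈ nearSpan d r} ∂(stdGaussian E) := Measure.prod_apply_symm hS
    _ = ∫⁻ _, P {v | (v, u) ∈ nearSpan d r} ∂(stdGaussian E) := by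
      refine lintegral_congr_ae ?_
      filter_upwards [hne] with g hg
      exact pi_stdGaussian_nearSpan_eq d r hg hu
    _ = _ := by simp

end RandomSubspace

/-- The columns of a Gaussian matrix are independent standard Gaussian vectors. -/
theorem IsGaussianMatrix.hasLaw_col {Ω : Type*} [MeasurableSpace Ω] {P : Measure Ω} {D d : ℕ}
    {A : Ω → Matrix (Fin D) (Fin d) ℝ} (hA : IsGaussianMatrix P A) :
    HasLaw (fun ω j => WithLp.toLp 2 fun i => A ω i j)
      (Measure.pi fun _ : Fin d => stdGaussian (EuclideanSpace ℝ (Fin D))) P := by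
  have h1 : HasLaw (fun ω (q : Fin d × Fin D) => A ω q.2 q.1)
      (Measure.pi fun _ => gaussianReal 0 1) P :=
    (hA.indep.precomp (g := Prod.swap) Prod.swap_injective).hasLaw_pi
      fun q => hA.hasLaw q.2 q.1
  have h2 : MeasurePreserving (MeasurableEquiv.curry (Fin d) (Fin D) ℝ)
      (Measure.pi fun _ : Fin d × Fin D => gaussianReal 0 1)
      (Measure.pi fun _ : Fin d => Measure.pi fun _ : Fin D => gaussianReal 0 1) := by
    refine ⟨MeasurableEquiv.measurable _, ?_⟩
    simpa only [Measure.infinitePi_eq_pi] using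
      Measure.infinitePi_map_curry (fun (_ : Fin d) (_ : Fin D) => gaussianReal 0 1)
  have h3 : MeasurePreserving (fun (x : Fin d → Fin D → ℝ) j => WithLp.toLp 2 (x j))
      (Measure.pi fun _ : Fin d => Measure.pi fun _ : Fin D => gaussianReal 0 1)
      (Measure.pi fun _ : Fin d => stdGaussian (EuclideanSpace ℝ (Fin D))) :=
    measurePreserving_pi _ _ fun _ => ⟨by fun_prop, map_pi_eq_stdGaussian⟩
  exact (h3.comp h2).comp_hasLaw h1

/-! ### The optimization problem -/

section Optimization

variable {D d : ℕ} {X : Set (EuclideanSpace ℝ (Fin D))} {f : EuclideanSpace ℝ (Fin D) → ℝ}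
  {L : ℝ≥0} {ε : ℝ} {xstar p : EuclideanSpace ℝ (Fin D)}

theorem optimalValue_eq_of_isMinOn (hxX : xstar ∈ X) (hmin : IsMinOn f X xstar) :
    optimalValue f X = f xstar :=
  IsLeast.csInf_eq ⟨mem_image_of_mem f hxX, by rintro _ ⟨x, hx, rfl⟩; exact hmin hx⟩

theorem lt_mul_norm_sub_of_notMem_epsMinimizers (hf : LipschitzOnWith L f X) (hxX : xstar ∈ X)
    (hmin : IsMinOn f X xstar) (hp : p ∈ X \ epsMinimizers f X ε) : ε < L * ‖xstar - p‖ := by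
  have h1 : f xstar + ε < f p := by
    by_contra! h
    exact hp.2 ⟨hp.1, by rwa [optimalValue_eq_of_isMinOn hxX hmin]⟩
  have h2 := hf.dist_le_mul p hp.1 xstar hxX
  rw [dist_comm p, dist_eq_norm xstar, Real.dist_eq] at h2
  linarith [le_abs_self (f p - f xstar)]

theorem isSuccessful_of_mem_nearSpan (hf : LipschitzOnWith L f X) (hL : 0 < (L : ℝ))
    (hxX : xstar ∈ X) (hmin : IsMinOn f X xstar) (hball : Metric.ball xstar (ε / L) ⊆ X)
    (hxp : 0 < ‖xstar - p‖)
    {B : Matrix (Fin D) (Fin d) ℝ}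
    (hB : ((fun j => WithLp.toLp 2 fun i => B i j), xstar - p) ∈
      nearSpan d (ε / (L * ‖xstar - p‖))) :
    IsSuccessful f X p ε B := by
  obtain ⟨y, hy⟩ := hB
  have hr : ε / (L * ‖xstar - p‖) * ‖xstar - p‖ = ε / L := by field_simp
  have hemb : embed B p (WithLp.toLp 2 y) - xstar =
      ∑ j, y j • (WithLp.toLp 2 fun i => B i j) - (xstar - p) := by
    ext i
    simp [embed, Matrix.mulVec, dotProduct, mul_comm]
    ring
  simp only [hr, ← hemb] at hy
  have hX : embed B p (WithLp.toLp 2 y) ∈ X := hball (by rwa [Metric.mem_ball, dist_eq_norm])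
  refine ⟨WithLp.toLp 2 y, hX, ?_⟩
  have h := hf.dist_le_mul _ hX xstar hxX
  rw [dist_eq_norm (embed _ _ _), Real.dist_eq] at h
  rw [lt_div_iff₀' hL] at hy
  rw [optimalValue_eq_of_isMinOn hxX hmin]
  linarith [le_abs_self (f (embed B p (WithLp.toLp 2 y)) - f xstar)]

end Optimization

end

theorem mainTheorem1 {Ω : Type*} [MeasurableSpace Ω] (P : Measure Ω) [IsProbabilityMeasure P]
    {D d : ℕ} (hd : 1 ≤ d) (hdD : d < D)
    (X : Set (EuclideanSpace ℝ (Fin D))) (f : EuclideanSpace ℝ (Fin D) → ℝ)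
    (L : ℝ≥0) (hf : LipschitzOnWith L f X)
    (ε : ℝ) (hε : 0 < ε)
    (A : Ω → Matrix (Fin D) (Fin d) ℝ) (hA : IsGaussianMatrix P A)
    (xstar : EuclideanSpace ℝ (Fin D)) (hxX : xstar ∈ X) (hmin : IsMinOn f X xstar)
    (hball : Metric.ball xstar (ε / L) ⊆ X)
    (p : EuclideanSpace ℝ (Fin D)) (hp : p ∈ X \ epsMinimizers f X ε) :
    tau (ε / (L * ‖xstar - p‖)) d D ≤ P.real {ω | IsSuccessful f X p ε (A ω)} := by
  have hlt := lt_mul_norm_sub_of_notMem_epsMinimizers hf hxX hmin hp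
  have hmul : 0 < (L : ℝ) * ‖xstar - p‖ := hε.trans hlt
  have hxp : 0 < ‖xstar - p‖ := pos_of_mul_pos_right hmul L.2
  have hL : 0 < (L : ℝ) := pos_of_mul_pos_left hmul hxp.le
  have hlaw := hA.hasLaw_col
  have key := tau_le_pi_stdGaussian_nearSpan (E := EuclideanSpace ℝ (Fin D)) hd
    (by simpa using hdD) (div_pos hε hmul) ((div_lt_one hmul).2 hlt) (norm_pos_iff.1 hxp)
  have hmeas : MeasurableSet {v : Fin d → EuclideanSpace ℝ (Fin D) |
      (v, xstar - p) ∈ nearSpan d (ε / (L * ‖xstar - p‖))} :=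
    ((isOpen_nearSpan d _).preimage (by fun_prop :
      Continuous fun v : Fin d → EuclideanSpace ℝ (Fin D) => (v, xstar - p))).measurableSet
  rw [finrank_euclideanSpace_fin, ← hlaw.measure_eq hmeas] at key
  -- the success event need not be measurable; it contains a measurable event of large probability
  refine (ENNReal.ofReal_le_iff_le_toReal (measure_ne_top _ _)).1 (key.trans (measure_mono ?_))
  exact fun ω hω => isSuccessful_of_mem_nearSpan hf hL hxX hmin hball hxp hω
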